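/- Conventions. A clause is a finite set of literals and a CNF formula is a finite set of clauses; the width of a clause is its number of literals, and a $k$-CNF is a CNF formula all of whose clauses have at most $k$ literals. Let $\varphi$ be a CNF formula in variables $z_1,\dots,z_N$ and let $m=2^\ell$. The formula $\varphi\circ\mathrm{IND}_m^N$ has variables $x_{i,t}$ ($1\le i\le N$, $0\le t<\ell$) and $y_{i,j}$ ($1\le i\le N$, $0\le j<m$). It is obtained by replacing each clause $z_{i_1}^{b_1}\lor\dots\lor z_{i_r}^{b_r}$ of $\varphi$ (where $z^1=z$ and $z^0=\overline z$) by the $m^r$ clauses, one for each tuple $(j_1,\dots,j_r)\in\{0,\dots,m-1\}^r$, that express: if for every $s$ the bits $x_{i_s,\ell-1}\cdots x_{i_s,0}$ are the binary representation of $j_s$, then $y_{i_1,j_1}^{b_1}\lor\dots\lor y_{i_r,j_r}^{b_r}$. For an unsatisfiable CNF formula $\psi$ in a finite set $Z$ of variables: * A resolution refutation of $\psi$ is a sequence of clauses ending in the empty clause, each of which is a clause of $\psi$ or follows from two earlier ones by the rule $\frac{A\lor z,\ B\lor\overline z}{A\lor B}$. $\mathrm{width}_{Res}(\psi)$ is the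 minimum, over all resolution refutations of $\psi$, of the width of the widest clause in the refutation. $\mathrm{tree}_{Res}(\psi)$ is the minimum size (number of lines, i.e. nodes of the proof tree, including the leaves) of a tree-like resolution refutation of $\psi$. * A $Res(\oplus)$ refutation of $\psi$ is a sequence of affine subspaces of $\mathbb F_2^Z$ (the empty set being allowed) ending in $\mathbb F_2^Z$, each of which is the set of assignments falsifying some clause of $\psi$, or is a subspace $C$ with $C\subseteq A\cup B$ for two (possibly equal) earlier subspaces $A,B$. $\mathrm{tree}_{Res(\oplus)}(\psi)$ is the minimum size (number of lines) of a tree-like $Res(\oplus)$ refutation of $\psi$. Statement. There is an absolute constant $\ell_0$ such that for all integers $\ell\ge\ell_0$, with $m=2^\ell$, all integers $N,k\ge 0$, and every unsatisfiable $k$-CNF formula $\varphi$ with $M$ clauses on $N$ Boolean variables, the following hold. 1. $\varphi\circ\mathrm{IND}_m^N$ is a $k(\ell+1)$-CNF formula on $N(\ell+m)$ variables with at most $m^kM$ clauses. If every clause of $\varphi$ has exactly $k$ literals, then it has exactly $m^kM$ clauses; if moreover the $k$ literals of each clause are on distinct variables, then every clause of $\varphi\circ\mathrm{IND}_m^N$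 has exactly $k(\ell+1)$ literals, and they are on distinct variables. 2. $$\mathrm{tree}_{Res(\oplus)}(\varphi\circ\mathrm{IND}_m^N)\ \ge\ \mathrm{tree}_{Res}(\varphi)\ \ge\ 2^{\mathrm{width}_{Res}(\varphi)-k}.$$ -/

import Mathlib

namespace ProofComplexity

/-- A literal over the variables `V`: the pair `(v, b)` is the literal `v ^ b`, which is true under
an assignment `a : V → 𝔽₂` exactly when `a v = b`; so `(v, 1)` is `v` and `(v, 0)` is `¬ v`. -/
abbrev Literal (V : Type*) := V × ZMod 2

/-- A clause is the disjunction of a finite set of literals; its length is the number of these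
literals, and `∅` is the empty clause `⊥`. -/
abbrev Clause (V : Type*) := Finset (Literal V)

/-- A CNF formula is the conjunction of a finite set of clauses. -/
abbrev CNF (V : Type*) := Finset (Clause V)

/-- The set (a sub-cube of `𝔽₂ ^ V`) of the assignments that falsify the clause `C`. -/
def Clause.falsifiers {V : Type*} (C : Clause V) : Set (V → ZMod 2) :=
  {a | ∀ p ∈ C, a p.1 ≠ p.2}

/-- The literals of `C` are on pairwise distinct variables. -/
def Clause.DistinctVars {V : Type*} (C : Clause V) : Prop :=
  Set.InjOn Prod.fst (C : Set (Literal V))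

/-- Every assignment falsifies some clause. -/
def CNF.Unsat {V : Type*} (φ : CNF V) : Prop :=
  ∀ a : V → ZMod 2, ∃ C ∈ φ, a ∈ Clause.falsifiers C

/-- Every clause has at most `k` literals. -/
def CNF.IsKCNF {V : Type*} (φ : CNF V) (k : ℕ) : Prop :=
  ∀ C ∈ φ, C.card ≤ k

section Resolution

variable {V : Type*} [DecidableEq V]

/-- The resolution rule: `A ∨ B` follows from `A ∨ v` and `B ∨ ¬ v`. -/
def Resolvent (D E C : Clause V) : Prop :=
  ∃ (v : V) (A B : Clause V), D = insert (v, 1) A ∧ E = insert (v, 0) B ∧ C = A ∪ B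

/-- `π 0, …, π n` is a resolution refutation of `φ`. -/
def IsResRefutation (φ : CNF V) {n : ℕ} (π : Fin (n + 1) → Clause V) : Prop :=
  π (Fin.last n) = ∅ ∧
    ∀ i, π i ∈ φ ∨ ∃ j < i, ∃ j' < i, Resolvent (π j) (π j') (π i)

/-- `width_Res(φ)`: the minimum, over all resolution refutations of `φ`, of the length of the
longest clause in the refutation. -/
noncomputable def widthRes (φ : CNF V) : ℕ :=
  sInf {w | ∃ (n : ℕ) (π : Fin (n + 1) → Clause V),
    IsResRefutation φ π ∧ ∀ i, (π i).card ≤ w}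

/-- `TreeResDerives φ C s`: there is a tree-like resolution derivation of the clause `C` from `φ`
with exactly `s` lines (nodes of the tree, leaves included). -/
inductive TreeResDerives (φ : CNF V) : Clause V → ℕ → Prop
  | leaf {C : Clause V} : C ∈ φ → TreeResDerives φ C 1
  | resolve {D E C : Clause V} {s t : ℕ} : TreeResDerives φ D s → TreeResDerives φ E t →
      Resolvent D E C → TreeResDerives φ C (s + t + 1)

/-- `tree_Res(φ)`: the minimum size (number of lines) of a tree-resolution refutation of `φ`. -/
noncomputable def treeRes (φ : CNF V) : ℕ :=
  sInf {s | TreeResDerives φ ∅ s}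

end Resolution

section ResolutionParity

variable {V : Type*}

/-- `TreeResParityDerives φ C s`: there is a tree-like `Res(⊕)` derivation of the affine subspace
`C` of `𝔽₂ ^ V` from `φ` with exactly `s` lines. A line is the subspace of all the assignments that
falsify it. It is the sub-cube of a clause of `φ`, or it is contained in the union of its premises,
which are two lines, or (when the rule is applied to one and the same line) a single line. -/
inductive TreeResParityDerives (φ : CNF V) : AffineSubspace (ZMod 2) (V → ZMod 2) → ℕ → Prop
  | leaf {C : AffineSubspace (ZMod 2) (V → ZMod 2)} {D : Clause V} : D ∈ φ →
      (C : Set (V → ZMod 2)) = Clause.falsifiers D → TreeResParityDerives φ C 1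
  | weaken {A C : AffineSubspace (ZMod 2) (V → ZMod 2)} {s : ℕ} : TreeResParityDerives φ A s →
      (C : Set (V → ZMod 2)) ⊆ A → TreeResParityDerives φ C (s + 1)
  | infer {A B C : AffineSubspace (ZMod 2) (V → ZMod 2)} {s t : ℕ} :
      TreeResParityDerives φ A s → TreeResParityDerives φ B t →
      (C : Set (V → ZMod 2)) ⊆ (A : Set (V → ZMod 2)) ∪ B →
      TreeResParityDerives φ C (s + t + 1)

/-- `tree_Res(⊕)(φ)`: the minimum size (number of lines) of a tree-like `Res(⊕)` refutation of `φ`,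
that is, of a derivation of the whole space `𝔽₂ ^ V`. -/
noncomputable def treeResParity (φ : CNF V) : ℕ :=
  sInf {s | TreeResParityDerives φ ⊤ s}

end ResolutionParity

/-- The variables of a formula lifted by `IND_m ^ N`, `m = 2 ^ ℓ`: the `x i t` with `i < N` and
`t < ℓ`, and the `y i j` with `i < N` and `j < m`. -/
abbrev IndVar (N ℓ : ℕ) := (Fin N × Fin ℓ) ⊕ (Fin N × Fin (2 ^ ℓ))

/-- The variable `x i t`. -/
abbrev IndVar.x {N ℓ : ℕ} (i : Fin N) (t : Fin ℓ) : IndVar N ℓ := Sum.inl (i, t)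

/-- The variable `y i j`. -/
abbrev IndVar.y {N ℓ : ℕ} (i : Fin N) (j : Fin (2 ^ ℓ)) : IndVar N ℓ := Sum.inr (i, j)

/-- The literal which says that `x i t` differs from the bit number `t` (of weight `2 ^ t`)
of `j`. -/
def xDiffers {N ℓ : ℕ} (i : Fin N) (j : Fin (2 ^ ℓ)) (t : Fin ℓ) : Literal (IndVar N ℓ) :=
  (IndVar.x i t, if j.val.testBit t then 0 else 1)

/-- For a clause `z_{i₁}^{b₁} ∨ … ∨ z_{i_r}^{b_r}` and a tuple `j` of indices, one for each of its
literals, the clause which says: if, for each `s`, the bits `x i_s *` encode `j_s`, then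
`y_{i₁,j₁}^{b₁} ∨ … ∨ y_{i_r,j_r}^{b_r}`. -/
def liftClause {N ℓ : ℕ} (C : Clause (Fin N)) (j : {p // p ∈ C} → Fin (2 ^ ℓ)) :
    Clause (IndVar N ℓ) :=
  C.attach.biUnion fun p =>
    insert (IndVar.y p.1.1 (j p), p.1.2) (Finset.univ.image (xDiffers p.1.1 (j p)))

/-- The formula `φ ∘ IND_m ^ N` with `m = 2 ^ ℓ`: each clause is replaced by the clauses
`liftClause C j` for all tuples `j`. -/
def liftInd {N : ℕ} (φ : CNF (Fin N)) (ℓ : ℕ) : CNF (IndVar N ℓ) :=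
  φ.biUnion fun C => Finset.univ.image fun j : {p // p ∈ C} → Fin (2 ^ ℓ) => liftClause C j

end ProofComplexity

open ProofComplexity

/-! The bound by `treeRes` turns a tree-like Res(⊕) refutation of the lift into a tree-like
resolution refutation of φ with no more lines. Follow the tree from the root to its leaves, keeping
a partial assignment ρ of the variables of φ and an affine set P inside the current line; on P the
gadgets assigned by ρ have their values, and the other blocks are free (`Respects`). At an inference
C ⊆ A ∪ B, project P ∩ A and P ∩ B to the free blocks. If one projection is everything, move to that
premise. Otherwise two proper affine sets cover the space, so they are parallel hyperplanes, and
flipping some variable w changes sides (`exists_mem_or_add_single_mem`). On either side w is thus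
determined by the other free variables, which remain unconstrained. Since w alone cannot control the
gadget (`exists_stifling`), the rest of its block can be fixed to force 0 on one side and 1 on the
other. Such a branching becomes a resolution step on the corresponding variable of φ, and at a leaf
ρ falsifies a clause of φ.

The width bound is the Ben-Sasson–Wigderson argument: of two premises, the smaller has at most half
the lines. Refute it with one more literal in the context, then use the result to remove the pivot
from the larger one (`TreeResDerives.exists_widthDerives`). -/

namespace ProofComplexity

/-! ### Width from tree-like size in resolution -/

section Width

variable {V : Type*} [DecidableEq V]

/-- `WidthDerives φ w C`: the clause `C` has a resolution derivation from `φ` all of whose clauses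
have at most `w` literals. -/
inductive WidthDerives (φ : CNF V) (w : ℕ) : Clause V → Prop
  | leaf {C : Clause V} : C ∈ φ → C.card ≤ w → WidthDerives φ w C
  | resolve {D E C : Clause V} : WidthDerives φ w D → WidthDerives φ w E →
      Resolvent D E C → C.card ≤ w → WidthDerives φ w C

theorem WidthDerives.exists_sequence {φ : CNF V} {w : ℕ} {C : Clause V}
    (h : WidthDerives φ w C) :
    ∃ (n : ℕ) (f : ℕ → Clause V), f n = C ∧ ∀ i ≤ n, (f i).card ≤ w ∧
      (f i ∈ φ ∨ ∃ j < i, ∃ j' < i, Resolvent (f j) (f j') (f i)) := by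
  induction h with
  | @leaf C hC hw => exact ⟨0, fun _ => C, rfl, fun i _ => ⟨hw, Or.inl hC⟩⟩
  | @resolve D E C _ _ hr hw ihD ihE =>
    obtain ⟨n, f, hfn, hf⟩ := ihD
    obtain ⟨n', g, hgn, hg⟩ := ihE
    -- Concatenation: `f` occupies positions 0 to n, `g` positions n + 1 to n + 1 + n', and C comes
    -- last.
    let h : ℕ → Clause V := fun i =>
      if i ≤ n then f i else if i ≤ n + 1 + n' then g (i - (n + 1)) else C
    have h1 : ∀ i ≤ n, h i = f i := fun i hi => if_pos hi
    have h2 : ∀ i ≤ n', h (n + 1 + i) = g i := by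
      intro i hi
      have e1 : ¬ n + 1 + i ≤ n := by omega
      have e2 : n + 1 + i ≤ n + 1 + n' := by omega
      simp only [h, if_neg e1, if_pos e2, Nat.add_sub_cancel_left]
    have h3 : h (n + 1 + n' + 1) = C := by
      have e1 : ¬ n + 1 + n' + 1 ≤ n := by omega
      have e2 : ¬ n + 1 + n' + 1 ≤ n + 1 + n' := by omega
      simp only [h, if_neg e1, if_neg e2]
    refine ⟨n + 1 + n' + 1, h, h3, fun i hi => ?_⟩
    rcases Nat.lt_or_ge n i with hni | hni
    · rcases Nat.lt_or_ge (n + 1 + n') i with hi' | hi'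
      · obtain rfl : i = n + 1 + n' + 1 := by omega
        rw [h3]
        refine ⟨hw, Or.inr ⟨n, by omega, n + 1 + n', by omega, ?_⟩⟩
        rw [h1 n le_rfl, h2 n' le_rfl, hfn, hgn]
        exact hr
      · obtain ⟨i, rfl⟩ := Nat.exists_eq_add_of_le (Nat.succ_le_of_lt hni)
        have hin : i ≤ n' := by omega
        rw [Nat.succ_eq_add_one, h2 i hin]
        refine ⟨(hg i hin).1, (hg i hin).2.imp_right ?_⟩
        rintro ⟨j, hj, j', hj', hres⟩
        refine ⟨n + 1 + j, by omega, n + 1 + j', by omega, ?_⟩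
        rwa [h2 j (by omega), h2 j' (by omega)]
    · rw [h1 i hni]
      refine ⟨(hf i hni).1, (hf i hni).2.imp_right ?_⟩
      rintro ⟨j, hj, j', hj', hres⟩
      refine ⟨j, hj, j', hj', ?_⟩
      rwa [h1 j (by omega), h1 j' (by omega)]

theorem widthRes_le_of_widthDerives {φ : CNF V} {w : ℕ} (h : WidthDerives φ w ∅) :
    widthRes φ ≤ w := by
  obtain ⟨n, f, hfn, hf⟩ := h.exists_sequence
  refine Nat.sInf_le ⟨n, fun i => f i, ⟨by simpa using hfn, fun i => ?_⟩, fun i => ?_⟩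
  · refine (hf i (by omega)).2.imp_right ?_
    rintro ⟨j, hj, j', hj', hres⟩
    exact ⟨⟨j, by omega⟩, hj, ⟨j', by omega⟩, hj', hres⟩
  · exact (hf i (by omega)).1

/-- Cutting a literal and its negation, with a weakened conclusion `F`. -/
theorem WidthDerives.exists_subset_of_cut {φ : CNF V} {w : ℕ} {D E F : Clause V} {v : V}
    {b : ZMod 2} (hD : WidthDerives φ w D) (hE : WidthDerives φ w E)
    (hDF : D ⊆ insert (v, b) F) (hEF : E ⊆ insert (v, b + 1) F) (hF : F.card ≤ w) :
    ∃ G ⊆ F, WidthDerives φ w G := by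
  by_cases h1 : (v, b) ∈ D
  · by_cases h2 : (v, b + 1) ∈ E
    · have hsub : D.erase (v, b) ∪ E.erase (v, b + 1) ⊆ F :=
        Finset.union_subset (Finset.subset_insert_iff.1 hDF) (Finset.subset_insert_iff.1 hEF)
      have hcard := (Finset.card_le_card hsub).trans hF
      refine ⟨_, hsub, ?_⟩
      have hb : b = 0 ∨ b = 1 := (by decide : ∀ b : ZMod 2, b = 0 ∨ b = 1) b
      rcases hb with rfl | rfl
      · rw [Finset.union_comm] at hcard ⊢
        exact .resolve hE hD ⟨v, _, _, (Finset.insert_erase h2).symm,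
          (Finset.insert_erase h1).symm, rfl⟩ hcard
      · exact .resolve hD hE ⟨v, _, _, (Finset.insert_erase h1).symm,
          (Finset.insert_erase h2).symm, rfl⟩ hcard
    · exact ⟨E, (Finset.subset_insert_iff_of_notMem h2).1 hEF, hE⟩
  · exact ⟨D, (Finset.subset_insert_iff_of_notMem h1).1 hDF, hD⟩

/-- The literals of G are cut away one at a time against the units modulo F. Every intermediate
clause stays inside G ∪ F, so the width never exceeds that of the starting bound. -/
theorem WidthDerives.exists_subset_of_units {φ : CNF V} {w : ℕ} {F : Clause V} (G : Clause V) :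
    ∀ D : Clause V, WidthDerives φ w D → D ⊆ G ∪ F → (G ∪ F).card ≤ w →
      (∀ l ∈ G, l ∈ F ∨ ∃ E ⊆ insert (l.1, l.2 + 1) F, WidthDerives φ w E) →
      ∃ E ⊆ F, WidthDerives φ w E := by
  induction G using Finset.induction_on with
  | empty => intro D hD hDF _ _; exact ⟨D, by simpa using hDF, hD⟩
  | insert l G _ ih =>
    intro D hD hDF hw hunit
    have hsub : G ∪ F ⊆ insert l G ∪ F :=
      Finset.union_subset_union_left (Finset.subset_insert _ _)
    have hw' := (Finset.card_le_card hsub).trans hw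
    have hunit' := fun l hl => hunit l (Finset.mem_insert_of_mem hl)
    rcases hunit l (Finset.mem_insert_self _ _) with hl | ⟨E, hEF, hE⟩
    · refine ih D hD (fun x hx => ?_) hw' hunit'
      have := hDF hx
      simp only [Finset.mem_union, Finset.mem_insert] at this ⊢
      rcases this with (rfl | h) | h
      exacts [Or.inr hl, Or.inl h, Or.inr h]
    · rw [Finset.insert_union] at hDF
      obtain ⟨K, hKF, hK⟩ := hD.exists_subset_of_cut (F := G ∪ F) hE hDF
        (hEF.trans (Finset.insert_subset_insert _ Finset.subset_union_right)) hw'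
      exact ih K hK hKF hw' hunit'

/-- A tree-like derivation with fewer than `2 ^ (d + 1)` lines is turned into a derivation of
small width, relative to a set of literals `F` and to unit clauses modulo `F`. -/
theorem TreeResDerives.exists_widthDerives {φ : CNF V} {k w : ℕ} (hφ : CNF.IsKCNF φ k)
    {C : Clause V} {s : ℕ} (h : TreeResDerives φ C s) :
    ∀ (d : ℕ) (F : Clause V), s < 2 ^ (d + 1) → F.card + d + k ≤ w →
      (∀ l ∈ C, l ∈ F ∨ ∃ E ⊆ insert (l.1, l.2 + 1) F, WidthDerives φ w E) →
      ∃ E ⊆ F, WidthDerives φ w E := by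
  induction h with
  | @leaf C hC =>
    intro d F _ hw hunit
    have hk := hφ C hC
    refine WidthDerives.exists_subset_of_units C C (.leaf hC (by omega))
      Finset.subset_union_left ?_ hunit
    have := Finset.card_union_le C F
    omega
  | @resolve D E C s t hD hE hres ihD ihE =>
    intro d F hs hw hunit
    obtain ⟨v, A, B, rfl, rfl, rfl⟩ := hres
    have hpos : ∀ {C : Clause V} {s : ℕ}, TreeResDerives φ C s → 1 ≤ s := by
      intro C s h; cases h <;> omega
    have hs1 := hpos hD
    have hs2 := hpos hE
    -- Two premises and a conclusion make at least three lines, which excludes d = 0.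
    obtain ⟨d, rfl⟩ : ∃ d', d = d' + 1 := by
      refine Nat.exists_eq_succ_of_ne_zero ?_
      rintro rfl
      simp only [zero_add, pow_one] at hs
      omega
    have small : ∀ (b : ZMod 2) (A' : Clause V), (∀ l ∈ A', l ∈ A ∪ B) →
        ∀ l ∈ insert (v, b) A', l ∈ insert (v, b) F ∨
          ∃ E ⊆ insert (l.1, l.2 + 1) (insert (v, b) F), WidthDerives φ w E := by
      intro b A' hA' l hl
      rcases Finset.mem_insert.1 hl with rfl | hl
      · exact Or.inl (Finset.mem_insert_self _ _)
      · refine (hunit l (hA' l hl)).imp (Finset.mem_insert_of_mem) ?_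
        rintro ⟨E, hE, hE'⟩
        exact ⟨E, hE.trans (Finset.insert_subset_insert _ (Finset.subset_insert _ _)), hE'⟩
    have large : ∀ (b : ZMod 2) (A' : Clause V), (∀ l ∈ A', l ∈ A ∪ B) →
        (∃ E ⊆ insert (v, b + 1) F, WidthDerives φ w E) →
        ∀ l ∈ insert (v, b) A', l ∈ F ∨
          ∃ E ⊆ insert (l.1, l.2 + 1) F, WidthDerives φ w E := by
      intro b A' hA' hex l hl
      rcases Finset.mem_insert.1 hl with rfl | hl
      · exact Or.inr hex
      · exact hunit l (hA' l hl)
    have hcard : ∀ b : ZMod 2, (insert (v, b) F).card + d + k ≤ w := by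
      intro b
      have := Finset.card_insert_le (v, b) F
      omega
    have hAB : ∀ l ∈ A, l ∈ A ∪ B := fun l hl => Finset.mem_union_left _ hl
    have hBA : ∀ l ∈ B, l ∈ A ∪ B := fun l hl => Finset.mem_union_right _ hl
    rw [pow_succ] at hs
    -- At least one premise has fewer than 2 ^ (d + 1) lines. It is treated with its pivot literal
    -- added to F, at the cost of one unit of d; the outcome is the unit modulo F that handles the
    -- pivot in the other premise, where F and the budget are unchanged.
    rcases Nat.lt_or_ge s (2 ^ (d + 1)) with h | h
    · exact ihE (d + 1) F (by rw [pow_succ]; omega) hw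
        (large 0 B hBA (ihD d _ h (hcard 1) (small 1 A hAB)))
    · exact ihD (d + 1) F (by rw [pow_succ]; omega) hw
        (large 1 A hAB (ihE d _ (by omega) (hcard 0) (small 0 B hBA)))

theorem two_pow_widthRes_sub_le {φ : CNF V} {k s : ℕ} (hφ : CNF.IsKCNF φ k)
    (h : TreeResDerives φ ∅ s) : (2 : ℝ) ^ ((widthRes φ : ℤ) - (k : ℤ)) ≤ (s : ℝ) := by
  have hs : s ≠ 0 := by cases h <;> omega
  obtain ⟨E, hE, hE'⟩ := h.exists_widthDerives (w := Nat.log 2 s + k) hφ (Nat.log 2 s) ∅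
    (Nat.lt_pow_succ_log_self one_lt_two s) (by simp) (by simp)
  rw [Finset.subset_empty.1 hE] at hE'
  have hw := widthRes_le_of_widthDerives hE'
  calc (2 : ℝ) ^ ((widthRes φ : ℤ) - (k : ℤ)) ≤ (2 : ℝ) ^ ((Nat.log 2 s : ℕ) : ℤ) :=
        zpow_le_zpow_right₀ one_le_two (by omega)
    _ = ((2 ^ Nat.log 2 s : ℕ) : ℝ) := by push_cast; rw [zpow_natCast]
    _ ≤ s := by exact_mod_cast Nat.pow_log_le_self 2 hs

end Width

/-! ### Counting clauses and literals of the lifted formula -/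

section LiftedFormula

variable {N ℓ : ℕ}

theorem mem_liftClause {C : Clause (Fin N)} {j : {p // p ∈ C} → Fin (2 ^ ℓ)}
    {q : Literal (IndVar N ℓ)} :
    q ∈ liftClause C j ↔ ∃ p : {p // p ∈ C},
      q = (IndVar.y p.1.1 (j p), p.1.2) ∨ ∃ t, q = xDiffers p.1.1 (j p) t := by
  simp [liftClause, eq_comm]

/-- The y-literals of a lifted clause record both C and the tuple j, so different pairs give
different clauses and the count is exact. -/
theorem y_mem_liftClause {C : Clause (Fin N)} {j : {p // p ∈ C} → Fin (2 ^ ℓ)} {i : Fin N}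
    {u : Fin (2 ^ ℓ)} {b : ZMod 2} :
    ((IndVar.y i u, b) : Literal (IndVar N ℓ)) ∈ liftClause C j ↔
      ∃ h : (i, b) ∈ C, j ⟨(i, b), h⟩ = u := by
  rw [mem_liftClause]
  constructor
  · rintro ⟨⟨⟨i', b'⟩, hp⟩, h | ⟨t, h⟩⟩
    · simp only [Prod.mk.injEq, Sum.inr.injEq] at h
      obtain ⟨⟨rfl, rfl⟩, rfl⟩ := h
      exact ⟨hp, rfl⟩
    · simp [xDiffers] at h
  · rintro ⟨h, rfl⟩
    exact ⟨⟨(i, b), h⟩, Or.inl rfl⟩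

theorem mem_liftInd {φ : CNF (Fin N)} {D : Clause (IndVar N ℓ)} :
    D ∈ liftInd φ ℓ ↔ ∃ C ∈ φ, ∃ j : {p // p ∈ C} → Fin (2 ^ ℓ), liftClause C j = D := by
  simp [liftInd]

theorem eq_of_liftClause_eq {C C' : Clause (Fin N)} {j : {p // p ∈ C} → Fin (2 ^ ℓ)}
    {j' : {p // p ∈ C'} → Fin (2 ^ ℓ)} (h : liftClause C j = liftClause C' j') : C = C' := by
  ext ⟨i, b⟩
  constructor
  · intro hp
    have := (y_mem_liftClause (j := j)).2 ⟨hp, rfl⟩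
    rw [h] at this
    exact (y_mem_liftClause.1 this).1
  · intro hp
    have := (y_mem_liftClause (j := j')).2 ⟨hp, rfl⟩
    rw [← h] at this
    exact (y_mem_liftClause.1 this).1

theorem liftClause_injective (C : Clause (Fin N)) :
    Function.Injective (liftClause (ℓ := ℓ) C) := by
  intro j j' h
  funext ⟨⟨i, b⟩, hp⟩
  have := (y_mem_liftClause (j := j)).2 ⟨hp, rfl⟩
  rw [h] at this
  exact (y_mem_liftClause.1 this).2.symm

theorem xDiffers_injective (i : Fin N) (u : Fin (2 ^ ℓ)) :
    Function.Injective (xDiffers i u) := by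
  intro t t' h
  simpa [xDiffers] using congrArg Prod.fst h

theorem card_liftBlock (i : Fin N) (u : Fin (2 ^ ℓ)) (b : ZMod 2) :
    (insert ((IndVar.y i u, b) : Literal (IndVar N ℓ))
      (Finset.univ.image (xDiffers i u))).card = ℓ + 1 := by
  rw [Finset.card_insert_of_notMem (by simp [xDiffers]),
    Finset.card_image_of_injective _ (xDiffers_injective i u), Finset.card_univ, Fintype.card_fin]

theorem card_liftClause_le (C : Clause (Fin N)) (j : {p // p ∈ C} → Fin (2 ^ ℓ)) :
    (liftClause C j).card ≤ C.card * (ℓ + 1) := by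
  unfold liftClause
  refine Finset.card_biUnion_le.trans (le_of_eq ?_)
  rw [Finset.sum_congr rfl fun p _ => card_liftBlock p.1.1 (j p) p.1.2]
  simp

theorem card_liftClause {C : Clause (Fin N)} (hC : Clause.DistinctVars C)
    (j : {p // p ∈ C} → Fin (2 ^ ℓ)) : (liftClause C j).card = C.card * (ℓ + 1) := by
  unfold liftClause
  rw [Finset.card_biUnion, Finset.sum_congr rfl fun p _ => card_liftBlock p.1.1 (j p) p.1.2]
  · simp
  · intro p _ p' _ hne
    rw [Function.onFun, Finset.disjoint_left]
    intro q hq hq'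
    refine hne (Subtype.ext (hC p.2 p'.2 ?_))
    simp only [Finset.mem_insert, Finset.mem_image, Finset.mem_univ, true_and] at hq hq'
    rcases hq with rfl | ⟨t, rfl⟩ <;> rcases hq' with h | ⟨t', h⟩ <;> simp_all [xDiffers]

theorem distinctVars_liftClause {C : Clause (Fin N)} (hC : Clause.DistinctVars C)
    (j : {p // p ∈ C} → Fin (2 ^ ℓ)) : Clause.DistinctVars (liftClause C j) := by
  intro q hq q' hq' h
  obtain ⟨p, hp⟩ := mem_liftClause.1 hq
  obtain ⟨p', hp'⟩ := mem_liftClause.1 hq'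
  have hpp : p.1.1 = p'.1.1 := by
    rcases hp with rfl | ⟨t, rfl⟩ <;> rcases hp' with rfl | ⟨t', rfl⟩ <;> simp_all [xDiffers]
  obtain rfl : p = p' := Subtype.ext (hC p.2 p'.2 hpp)
  rcases hp with rfl | ⟨t, rfl⟩ <;> rcases hp' with rfl | ⟨t', rfl⟩ <;> simp_all [xDiffers]

theorem card_liftInd (φ : CNF (Fin N)) :
    (liftInd φ ℓ).card = ∑ C ∈ φ, (2 ^ ℓ) ^ C.card := by
  unfold liftInd
  rw [Finset.card_biUnion]
  · refine Finset.sum_congr rfl fun C _ => ?_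
    rw [Finset.card_image_of_injective _ (liftClause_injective C)]
    simp
  · intro C _ C' _ hne
    rw [Function.onFun, Finset.disjoint_left]
    intro D hD hD'
    obtain ⟨j, -, rfl⟩ := Finset.mem_image.1 hD
    obtain ⟨j', -, h⟩ := Finset.mem_image.1 hD'
    exact hne (eq_of_liftClause_eq h).symm

theorem card_liftInd_le {φ : CNF (Fin N)} {k : ℕ} (hφ : CNF.IsKCNF φ k) :
    (liftInd φ ℓ).card ≤ (2 ^ ℓ) ^ k * φ.card := by
  rw [card_liftInd, mul_comm, ← smul_eq_mul]
  exact Finset.sum_le_card_nsmul _ _ _ fun C hC =>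
    Nat.pow_le_pow_right (by positivity) (hφ C hC)

theorem card_liftInd_eq {φ : CNF (Fin N)} {k : ℕ} (hφ : ∀ C ∈ φ, C.card = k) :
    (liftInd φ ℓ).card = (2 ^ ℓ) ^ k * φ.card := by
  rw [card_liftInd, Finset.sum_congr rfl fun C hC => by rw [hφ C hC]]
  simp [mul_comm]

end LiftedFormula

/-! ### Existence of tree-like Res(⊕) refutations -/

section Completeness

variable {V : Type*}

/-- The affine subspace of the assignments that agree with `a` on `S`. -/
def agreeSubspace (a : V → ZMod 2) (S : Set V) : AffineSubspace (ZMod 2) (V → ZMod 2) where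
  carrier := {p | ∀ v ∈ S, p v = a v}
  smul_vsub_vadd_mem' := by
    intro c p₁ p₂ p₃ h₁ h₂ h₃ v hv
    simp [h₁ v hv, h₂ v hv, h₃ v hv]

theorem eq_of_ne_of_ne {a b c : ZMod 2} : a ≠ c → b ≠ c → a = b := by
  revert a b c; decide

theorem coe_agreeSubspace_eq_falsifiers {D : Clause V} {a : V → ZMod 2}
    (ha : a ∈ Clause.falsifiers D) :
    (agreeSubspace a {v | ∃ p ∈ D, p.1 = v} : Set (V → ZMod 2)) = Clause.falsifiers D := by
  ext p
  constructor
  · intro hp q hq h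
    rw [hp q.1 ⟨q, hq, rfl⟩] at h
    exact ha q hq h
  · rintro hp v ⟨q, hq, rfl⟩
    exact eq_of_ne_of_ne (hp q hq) (ha q hq)

/-- This is the full decision tree, with S the variables still to be queried. Existence matters
because the infimum defining `treeResParity` would be 0 over an empty set. -/
theorem CNF.Unsat.exists_treeResParityDerives_agreeSubspace [Fintype V] [DecidableEq V]
    {ψ : CNF V} (hψ : CNF.Unsat ψ) (S : Finset V) :
    ∀ a : V → ZMod 2, ∃ s, TreeResParityDerives ψ (agreeSubspace a (Sᶜ : Finset V)) s := by
  induction S using Finset.induction_on with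
  | empty =>
    intro a
    obtain ⟨D, hD, ha⟩ := hψ a
    refine ⟨_, .weaken (.leaf hD (coe_agreeSubspace_eq_falsifiers ha)) fun p hp v _ => ?_⟩
    exact hp v (by simp)
  | insert w S _ ih =>
    intro a
    obtain ⟨s, hs⟩ := ih (Function.update a w 0)
    obtain ⟨t, ht⟩ := ih (Function.update a w 1)
    refine ⟨_, .infer hs ht fun p hp => ?_⟩
    have key : ∀ b, p w = b →
        p ∈ agreeSubspace (Function.update a w b) ((Sᶜ : Finset V) : Set V) := by
      intro b hb v hv
      by_cases hvw : v = w
      · subst hvw; simpa using hb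
      · rw [Function.update_of_ne hvw]
        exact hp v (by simpa [hvw] using hv)
    exact ((by decide : ∀ b : ZMod 2, b = 0 ∨ b = 1) (p w)).imp (key 0) (key 1)

theorem CNF.Unsat.exists_treeResParityDerives [Fintype V] {ψ : CNF V} (hψ : CNF.Unsat ψ) :
    ∃ s, TreeResParityDerives ψ ⊤ s := by
  classical
  obtain ⟨s, hs⟩ := hψ.exists_treeResParityDerives_agreeSubspace Finset.univ 0
  exact ⟨_, .weaken hs fun p _ v hv => by simp at hv⟩

end Completeness

/-! ### Coverings of the space by two affine sets -/

section TernarySum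

variable {V : Type*}

/-- Closure under sums of three elements: over `𝔽₂` these are the affine subspaces and `∅`. -/
def TernarySumClosed (X : Set (V → ZMod 2)) : Prop :=
  ∀ a ∈ X, ∀ b ∈ X, ∀ c ∈ X, a + b + c ∈ X

theorem add_self_zmod_two (a : V → ZMod 2) : a + a = 0 := by
  funext v
  exact CharTwo.add_self_eq_zero (a v)

theorem ternarySumClosed_coe (A : AffineSubspace (ZMod 2) (V → ZMod 2)) :
    TernarySumClosed (A : Set (V → ZMod 2)) := by
  intro a ha b hb c hc
  have h := A.smul_vsub_vadd_mem 1 ha hb hc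
  have e : (1 : ZMod 2) • (a -ᵥ b) +ᵥ c = a + b + c := by
    rw [one_smul, vsub_eq_sub, vadd_eq_add, sub_eq_add_neg,
      neg_eq_of_add_eq_zero_left (add_self_zmod_two b)]
  rwa [e] at h

theorem TernarySumClosed.inter {X Y : Set (V → ZMod 2)} (hX : TernarySumClosed X)
    (hY : TernarySumClosed Y) : TernarySumClosed (X ∩ Y) := fun a ha b hb c hc =>
  ⟨hX a ha.1 b hb.1 c hc.1, hY a ha.2 b hb.2 c hc.2⟩

variable [DecidableEq V]

/-- A nonempty set of assignments that is closed under all flips of one variable is everything. -/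
theorem eq_univ_of_add_single_mem [Fintype V] {X : Set (V → ZMod 2)} (hne : X.Nonempty)
    (h : ∀ w, ∀ a ∈ X, a + Pi.single w 1 ∈ X) : X = Set.univ := by
  obtain ⟨a, ha⟩ := hne
  have key : ∀ (S : Finset V) (c : V → ZMod 2), a + ∑ w ∈ S, Pi.single w (c w) ∈ X := by
    intro S c
    induction S using Finset.induction_on with
    | empty => simpa using ha
    | insert w S hw ih =>
      rw [Finset.sum_insert hw, add_left_comm, add_comm]
      rcases (by decide : ∀ b : ZMod 2, b = 0 ∨ b = 1) (c w) with hc | hc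
      · simpa [hc] using ih
      · rw [hc]; exact h w _ ih
  refine Set.eq_univ_of_forall fun p => ?_
  have := key Finset.univ (p - a)
  rwa [Finset.univ_sum_single, add_sub_cancel] at this

/-- Two proper affine subspaces covering the whole space are parallel hyperplanes, and some
variable separates them. -/
theorem exists_mem_or_add_single_mem [Fintype V] {X Y : Set (V → ZMod 2)}
    (hX : TernarySumClosed X) (hY : TernarySumClosed Y) (hXY : X ∪ Y = Set.univ)
    (hX' : X ≠ Set.univ) (hY' : Y ≠ Set.univ) :
    ∃ w, (∀ a ∈ X, a + Pi.single w 1 ∉ X) ∧ ∀ a,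
      (a ∈ X ∨ a + Pi.single w 1 ∈ X) ∧ (a ∈ Y ∨ a + Pi.single w 1 ∈ Y) := by
  have hcov : ∀ a, a ∉ X → a ∈ Y := fun a ha =>
    ((Set.ext_iff.1 hXY a).2 trivial).resolve_left ha
  have hcov' : ∀ a, a ∉ Y → a ∈ X := fun a ha =>
    ((Set.ext_iff.1 hXY a).2 trivial).resolve_right ha
  obtain ⟨u, hu⟩ := (Set.ne_univ_iff_exists_notMem _).1 hY'
  have hne : X.Nonempty := ⟨u, hcov' u hu⟩
  have hcancel : ∀ a b : V → ZMod 2, a + b + b = a := fun a b => by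
    rw [add_assoc, add_self_zmod_two, add_zero]
  -- X is nonempty and proper, so some flip leaves X at some point; by affinity it then does so at
  -- every point of X.
  obtain ⟨w, x, hx, hxw⟩ : ∃ w, ∃ x ∈ X, x + Pi.single w 1 ∉ X := by
    by_contra! h
    exact hX' (eq_univ_of_add_single_mem hne h)
  have hflip : ∀ a ∈ X, a + Pi.single w 1 ∉ X := by
    intro a ha ha'
    refine hxw ?_
    have := hX x hx a ha _ ha'
    rwa [← add_assoc, hcancel] at this
  have hflipY : ∀ a ∈ Y, a + Pi.single w 1 ∉ Y := by
    intro a ha ha'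
    -- The point u lies outside Y, hence in X, so its flip lies in Y; adding the pair a, a + e_w
    -- would bring u back into Y.
    have hXsub : u ∈ Y := by
      have := hY _ (hcov _ (hflip u (hcov' u hu))) a ha _ ha'
      rw [show u + Pi.single w 1 + a + (a + Pi.single w 1)
        = u + (a + a) + (Pi.single w 1 + Pi.single w 1) by abel] at this
      simpa [add_self_zmod_two] using this
    exact hu hXsub
  refine ⟨w, hflip, fun a => ⟨?_, ?_⟩⟩
  · by_contra! h
    exact hflipY a (hcov a h.1) (hcov _ h.2)
  · by_contra! h
    exact hflip a (hcov' a h.1) (hcov' _ h.2)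

end TernarySum

/-! ### Simulation of Res(⊕) on the lift by resolution -/

section Simulation

variable {N ℓ : ℕ}

/-- The block `i < N` of a variable `x i t` or `y i j`. -/
def IndVar.block : IndVar N ℓ → Fin N := Sum.elim Prod.fst Prod.fst

/-- The bits `x i _` encode the index `u`. -/
def Encodes (a : IndVar N ℓ → ZMod 2) (i : Fin N) (u : Fin (2 ^ ℓ)) : Prop :=
  ∀ t : Fin ℓ, a (IndVar.x i t) = if u.val.testBit t then 1 else 0

/-- The gadget on block `i` has the value `b`. -/
def GadgetValue (a : IndVar N ℓ → ZMod 2) (i : Fin N) (b : ZMod 2) : Prop :=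
  ∀ u, Encodes a i u → a (IndVar.y i u) = b

theorem exists_encodes (a : IndVar N ℓ → ZMod 2) (i : Fin N) : ∃ u, Encodes a i u := by
  refine ⟨⟨Nat.ofBits fun t : Fin ℓ => decide (a (IndVar.x i t) = 1), Nat.ofBits_lt_two_pow _⟩,
    fun t => ?_⟩
  rw [Nat.testBit_ofBits_lt _ _ t.isLt]
  rcases (by decide : ∀ b : ZMod 2, b = 0 ∨ b = 1) (a (IndVar.x i t)) with h | h <;> simp [h]

theorem encodes_unique {a : IndVar N ℓ → ZMod 2} {i : Fin N} {u u' : Fin (2 ^ ℓ)}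
    (h : Encodes a i u) (h' : Encodes a i u') : u = u' := by
  refine Fin.ext (Nat.eq_of_testBit_eq fun t => ?_)
  by_cases ht : t < ℓ
  · have := (h ⟨t, ht⟩).symm.trans (h' ⟨t, ht⟩)
    revert this
    cases u.val.testBit t <;> cases u'.val.testBit t <;> simp
  · have hle : 2 ^ ℓ ≤ 2 ^ t := Nat.pow_le_pow_right (by norm_num) (not_lt.1 ht)
    rw [Nat.testBit_lt_two_pow (u.isLt.trans_le hle), Nat.testBit_lt_two_pow (u'.isLt.trans_le hle)]

theorem ne_xDiffers_iff {a : IndVar N ℓ → ZMod 2} {i : Fin N} {u : Fin (2 ^ ℓ)} {t : Fin ℓ} :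
    a (xDiffers i u t).1 ≠ (xDiffers i u t).2 ↔
      a (IndVar.x i t) = if u.val.testBit t then 1 else 0 := by
  simp only [xDiffers]
  generalize a (IndVar.x i t) = b
  cases u.val.testBit t <;> revert b <;> decide

theorem mem_falsifiers_liftClause {C : Clause (Fin N)} {j : {p // p ∈ C} → Fin (2 ^ ℓ)}
    {a : IndVar N ℓ → ZMod 2} :
    a ∈ Clause.falsifiers (liftClause C j) ↔
      ∀ p : {p // p ∈ C}, Encodes a p.1.1 (j p) ∧ a (IndVar.y p.1.1 (j p)) ≠ p.1.2 := by
  constructor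
  · intro h p
    exact ⟨fun t => ne_xDiffers_iff.1 (h _ (mem_liftClause.2 ⟨p, Or.inr ⟨t, rfl⟩⟩)),
      h _ (mem_liftClause.2 ⟨p, Or.inl rfl⟩)⟩
  · intro h q hq
    obtain ⟨p, rfl | ⟨t, rfl⟩⟩ := mem_liftClause.1 hq
    · exact (h p).2
    · exact ne_xDiffers_iff.2 ((h p).1 t)

theorem CNF.Unsat.liftInd {φ : CNF (Fin N)} (hφ : CNF.Unsat φ) :
    CNF.Unsat (liftInd φ ℓ) := by
  intro a
  choose u hu using exists_encodes a
  obtain ⟨C, hC, ha⟩ := hφ fun i => a (IndVar.y i (u i))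
  exact ⟨_, mem_liftInd.2 ⟨C, hC, fun p => u p.1.1, rfl⟩,
    mem_falsifiers_liftClause.2 fun p => ⟨hu _, ha _ p.2⟩⟩

/-- The indexing gadget is stifled by each single variable `w`: all the other variables of a block
can be fixed in such a way that the value of the gadget is `b`. -/
theorem exists_stifling (hℓ : 1 ≤ ℓ) (w : IndVar N ℓ) (i : Fin N) (b : ZMod 2) :
    ∃ f : IndVar N ℓ → ZMod 2, ∀ a : IndVar N ℓ → ZMod 2,
      (∀ v, IndVar.block v = i → v ≠ w → a v = f v) → GadgetValue a i b := by
  have : Nontrivial (Fin (2 ^ ℓ)) :=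
    Fin.nontrivial_iff_two_le.2 (by simpa using Nat.pow_le_pow_right two_pos hℓ)
  rcases w with ⟨i', t⟩ | ⟨i', u⟩
  -- If w is an address bit, setting all y-variables of the block to b makes the address irrelevant.
  · exact ⟨fun _ => b, fun a ha u _ => ha (IndVar.y i u) rfl (by simp)⟩
  -- If w is a y-variable, the address is made to point at another one; this needs m ≥ 2.
  · obtain ⟨u', hu'⟩ := exists_ne u
    refine ⟨Sum.elim (fun q => if u'.val.testBit q.2 then 1 else 0) fun _ => b,
      fun a ha u'' h'' => ?_⟩
    have h' : Encodes a i u' := fun t => ha (IndVar.x i t) rfl (by simp)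
    obtain rfl := encodes_unique h' h''
    exact ha (IndVar.y i u') rfl (by simp [hu'])

/-- `P` is an affine set of assignments that respects the values that `ρ` gives to some of the
gadgets, and leaves the blocks of the other gadgets entirely free. -/
structure Respects (ρ : Fin N → Option (ZMod 2)) (P : Set (IndVar N ℓ → ZMod 2)) : Prop where
  closed : TernarySumClosed P
  value : ∀ p ∈ P, ∀ i b, ρ i = some b → GadgetValue p i b
  free : ∀ a : IndVar N ℓ → ZMod 2, ∃ p ∈ P, ∀ v, ρ (IndVar.block v) = none → p v = a v

/-- `hfree` exempts w, since restricting to a hyperplane may make w depend on the other variables.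
Fixing the rest of the block to f gives the gadget the value b whatever w is. -/
theorem Respects.update {ρ : Fin N → Option (ZMod 2)} {P : Set (IndVar N ℓ → ZMod 2)}
    (hP : TernarySumClosed P) (hval : ∀ p ∈ P, ∀ i b, ρ i = some b → GadgetValue p i b)
    {w : IndVar N ℓ} {b : ZMod 2} {f : IndVar N ℓ → ZMod 2}
    (hw : ρ (IndVar.block w) = none)
    (hf : ∀ a : IndVar N ℓ → ZMod 2,
      (∀ v, IndVar.block v = IndVar.block w → v ≠ w → a v = f v) →
        GadgetValue a (IndVar.block w) b)
    (hfree : ∀ a : IndVar N ℓ → ZMod 2, ∃ p ∈ P,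
      ∀ v, ρ (IndVar.block v) = none → v ≠ w → p v = a v) :
    Respects (Function.update ρ (IndVar.block w) (some b))
      (P ∩ {p | ∀ v, IndVar.block v = IndVar.block w → v ≠ w → p v = f v}) where
  closed := by
    refine hP.inter fun a ha c hc d hd v hv hvw => ?_
    rw [Pi.add_apply, Pi.add_apply, ha v hv hvw, hc v hv hvw, hd v hv hvw,
      CharTwo.add_self_eq_zero, zero_add]
  value := by
    intro p hp i c hi
    by_cases h : i = IndVar.block w
    · subst h
      rw [Function.update_self, Option.some.injEq] at hi
      exact hi ▸ hf p hp.2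
    · rw [Function.update_of_ne h] at hi
      exact hval p hp.1 i c hi
  free := by
    intro a
    obtain ⟨p, hp, h⟩ := hfree fun v => if IndVar.block v = IndVar.block w then f v else a v
    refine ⟨p, ⟨hp, fun v hv hvw => ?_⟩, fun v hv => ?_⟩
    · rw [h v (by rw [hv, hw]) hvw, if_pos hv]
    · have hne : IndVar.block v ≠ IndVar.block w := by
        intro e
        rw [e, Function.update_self] at hv
        exact Option.some_ne_none _ hv
      rw [Function.update_of_ne hne] at hv
      rw [h v hv (fun e => hne (by rw [e])), if_neg hne]

/-- The clause falsified by exactly the extensions of the partial assignment `ρ`. -/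
def assignmentClause (ρ : Fin N → Option (ZMod 2)) : Clause (Fin N) :=
  Finset.univ.filter fun q => ρ q.1 = some (q.2 + 1)

theorem mem_assignmentClause {ρ : Fin N → Option (ZMod 2)} {q : Literal (Fin N)} :
    q ∈ assignmentClause ρ ↔ ρ q.1 = some (q.2 + 1) := by
  simp [assignmentClause]

theorem assignmentClause_update_subset (ρ : Fin N → Option (ZMod 2)) (i : Fin N) (b : ZMod 2) :
    assignmentClause (Function.update ρ i (some b)) ⊆ insert (i, b + 1) (assignmentClause ρ) := by
  rintro ⟨i', c⟩ h
  rw [mem_assignmentClause] at h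
  by_cases hi : i' = i
  · subst hi
    rw [Function.update_self, Option.some.injEq] at h
    have : c = b + 1 := by rw [h, add_assoc, CharTwo.add_self_eq_zero, add_zero]
    exact this ▸ Finset.mem_insert_self _ _
  · rw [Function.update_of_ne hi] at h
    exact Finset.mem_insert_of_mem (mem_assignmentClause.2 h)

/-- Resolution here has no weakening, so conclusions are only controlled up to inclusion; a premise
that lacks its pivot already suffices by itself. -/
theorem TreeResDerives.exists_subset_of_cut {V : Type*} [DecidableEq V] {φ : CNF V}
    {D E F : Clause V} {v : V} {s t : ℕ} (hD : TreeResDerives φ D s)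
    (hE : TreeResDerives φ E t) (hDF : D ⊆ insert (v, 1) F) (hEF : E ⊆ insert (v, 0) F) :
    ∃ G ⊆ F, ∃ r ≤ s + t + 1, TreeResDerives φ G r := by
  by_cases h1 : (v, 1) ∈ D
  · by_cases h2 : (v, 0) ∈ E
    · exact ⟨D.erase (v, 1) ∪ E.erase (v, 0),
        Finset.union_subset (Finset.subset_insert_iff.1 hDF) (Finset.subset_insert_iff.1 hEF),
        _, le_rfl, .resolve hD hE ⟨v, _, _, (Finset.insert_erase h1).symm,
          (Finset.insert_erase h2).symm, rfl⟩⟩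
    · exact ⟨E, (Finset.subset_insert_iff_of_notMem h2).1 hEF, t, by omega, hE⟩
  · exact ⟨D, (Finset.subset_insert_iff_of_notMem h1).1 hDF, s, by omega, hD⟩

/-- A clause whose lift is falsified on all of `P` is falsified by `ρ`. -/
theorem Respects.subset_assignmentClause {ρ : Fin N → Option (ZMod 2)}
    {P : Set (IndVar N ℓ → ZMod 2)} (hP : Respects ρ P) {C : Clause (Fin N)}
    {j : {p // p ∈ C} → Fin (2 ^ ℓ)} (h : P ⊆ Clause.falsifiers (liftClause C j)) :
    C ⊆ assignmentClause ρ := by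
  rintro ⟨i, b⟩ hq
  -- Putting b on all free blocks would satisfy the y-literal with sign b if block i were free.
  obtain ⟨p, hp, hpv⟩ := hP.free fun _ => b
  have hfals := mem_falsifiers_liftClause.1 (h hp) ⟨(i, b), hq⟩
  rw [mem_assignmentClause]
  cases hρ : ρ i with
  | none => exact absurd (hpv (IndVar.y i _) hρ) hfals.2
  | some c =>
    have hc := hP.value p hp i c hρ _ hfals.1
    have hne : c ≠ b := hc ▸ hfals.2
    rw [Option.some.injEq]
    revert hne
    exact (by decide : ∀ c b : ZMod 2, c ≠ b → c = b + 1) c b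

/-- The projection of `P` to the free blocks, as a cylinder. -/
def freeCylinder (ρ : Fin N → Option (ZMod 2)) (P : Set (IndVar N ℓ → ZMod 2)) :
    Set (IndVar N ℓ → ZMod 2) :=
  {a | ∃ p ∈ P, ∀ v, ρ (IndVar.block v) = none → p v = a v}

theorem TernarySumClosed.freeCylinder {P : Set (IndVar N ℓ → ZMod 2)} (hP : TernarySumClosed P)
    (ρ : Fin N → Option (ZMod 2)) : TernarySumClosed (freeCylinder ρ P) := by
  rintro a ⟨p, hp, hpa⟩ b ⟨q, hq, hqb⟩ c ⟨r, hr, hrc⟩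
  refine ⟨p + q + r, hP p hp q hq r hr, fun v hv => ?_⟩
  simp only [Pi.add_apply, hpa v hv, hqb v hv, hrc v hv]

/-- The invariant P ⊆ C passes from a line to a premise. Quantifying over ρ and P after the
induction on the tree lets each premise receive its own extension of ρ. -/
theorem TreeResParityDerives.exists_treeResDerives (hℓ : 1 ≤ ℓ) {φ : CNF (Fin N)}
    {C : AffineSubspace (ZMod 2) (IndVar N ℓ → ZMod 2)} {s : ℕ}
    (h : TreeResParityDerives (liftInd φ ℓ) C s) :
    ∀ (ρ : Fin N → Option (ZMod 2)) (P : Set (IndVar N ℓ → ZMod 2)), Respects ρ P →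
      P ⊆ (C : Set (IndVar N ℓ → ZMod 2)) →
      ∃ D ⊆ assignmentClause ρ, ∃ r ≤ s, TreeResDerives φ D r := by
  induction h with
  | leaf hD hC =>
    intro ρ P hP hPC
    obtain ⟨C, hCφ, j, rfl⟩ := mem_liftInd.1 hD
    exact ⟨C, hP.subset_assignmentClause (hPC.trans hC.subset), 1, le_rfl, .leaf hCφ⟩
  | weaken _ hsub ih =>
    intro ρ P hP hPC
    obtain ⟨D, hD, r, hr, h⟩ := ih ρ P hP (hPC.trans hsub)
    exact ⟨D, hD, r, by omega, h⟩
  | @infer A B C s t _ _ hsub ihA ihB =>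
    intro ρ P hP hPC
    have hXc := hP.closed.inter (ternarySumClosed_coe A)
    have hYc := hP.closed.inter (ternarySumClosed_coe B)
    have restrict : ∀ A : Set (IndVar N ℓ → ZMod 2), TernarySumClosed (P ∩ A) →
        freeCylinder ρ (P ∩ A) = Set.univ → Respects ρ (P ∩ A) := fun A hc hA =>
      ⟨hc, fun p hp => hP.value p hp.1, fun a => (Set.ext_iff.1 hA a).2 trivial⟩
    by_cases hX : freeCylinder ρ (P ∩ A) = Set.univ
    · obtain ⟨D, hD, r, hr, h⟩ := ihA ρ _ (restrict A hXc hX) Set.inter_subset_right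
      exact ⟨D, hD, r, by omega, h⟩
    by_cases hY : freeCylinder ρ (P ∩ B) = Set.univ
    · obtain ⟨D, hD, r, hr, h⟩ := ihB ρ _ (restrict B hYc hY) Set.inter_subset_right
      exact ⟨D, hD, r, by omega, h⟩
    have hcov : freeCylinder ρ (P ∩ A) ∪ freeCylinder ρ (P ∩ B) = Set.univ := by
      refine Set.eq_univ_of_forall fun a => ?_
      obtain ⟨p, hp, hpa⟩ := hP.free a
      exact (hsub (hPC hp)).imp (fun h => ⟨p, ⟨hp, h⟩, hpa⟩) fun h => ⟨p, ⟨hp, h⟩, hpa⟩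
    obtain ⟨w, hflip, hw⟩ :=
      exists_mem_or_add_single_mem (hXc.freeCylinder ρ) (hYc.freeCylinder ρ) hcov hX hY
    -- A flip outside the free blocks does not affect membership in a cylinder, whereas the flip of
    -- w leaves the nonempty cylinder of P ∩ A.
    have hwfree : ρ (IndVar.block w) = none := by
      by_contra hne
      have hsame : ∀ a p : IndVar N ℓ → ZMod 2,
          (∀ v, ρ (IndVar.block v) = none → p v = a v) →
          ∀ v, ρ (IndVar.block v) = none → p v = (a + Pi.single w 1 : IndVar N ℓ → ZMod 2) v := by
        intro a p h v hv
        have hvw : v ≠ w := fun e => hne (e ▸ hv)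
        simpa [hvw] using h v hv
      rcases (hw 0).1 with ⟨p, hp, h⟩ | ⟨p, hp, h⟩
      · exact hflip 0 ⟨p, hp, h⟩ ⟨p, hp, hsame 0 p h⟩
      · exact hflip _ ⟨p, hp, h⟩ ⟨p, hp, hsame _ p h⟩
    -- Every a or its flip at w lies in the projection, so the free variables other than w still
    -- take arbitrary values on P ∩ A.
    have branch : ∀ (A : Set (IndVar N ℓ → ZMod 2)) (b : ZMod 2), TernarySumClosed (P ∩ A) →
        (∀ a, a ∈ freeCylinder ρ (P ∩ A) ∨ a + Pi.single w 1 ∈ freeCylinder ρ (P ∩ A)) →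
        ∃ Q ⊆ A, Respects (Function.update ρ (IndVar.block w) (some b)) Q := by
      intro A b hc hA
      obtain ⟨f, hf⟩ := exists_stifling hℓ w (IndVar.block w) b
      refine ⟨_, Set.inter_subset_left.trans Set.inter_subset_right,
        Respects.update hc (fun p hp => hP.value p hp.1) hwfree hf fun a => ?_⟩
      rcases hA a with ⟨p, hp, h⟩ | ⟨p, hp, h⟩
      · exact ⟨p, hp, fun v hv _ => h v hv⟩
      · exact ⟨p, hp, fun v hv hvw => by simpa [hvw] using h v hv⟩
    obtain ⟨Q, hQA, hQ⟩ := branch A 0 hXc fun a => (hw a).1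
    obtain ⟨R, hRB, hR⟩ := branch B 1 hYc fun a => (hw a).2
    obtain ⟨D, hD, r, hr, hDr⟩ := ihA _ Q hQ hQA
    obtain ⟨E, hE, r', hr', hEr⟩ := ihB _ R hR hRB
    have e0 : (0 : ZMod 2) + 1 = 1 := by decide
    have e1 : (1 : ZMod 2) + 1 = 0 := by decide
    obtain ⟨G, hG, q, hq, hGq⟩ := hDr.exists_subset_of_cut hEr
      (hD.trans (e0 ▸ assignmentClause_update_subset ρ _ 0))
      (hE.trans (e1 ▸ assignmentClause_update_subset ρ _ 1))
    exact ⟨G, hG, q, by omega, hGq⟩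

theorem exists_treeResDerives_le_treeResParity (hℓ : 1 ≤ ℓ) {φ : CNF (Fin N)}
    (hφ : CNF.Unsat φ) : ∃ r ≤ treeResParity (liftInd φ ℓ), TreeResDerives φ ∅ r := by
  have hne : {s | TreeResParityDerives (liftInd φ ℓ) ⊤ s}.Nonempty :=
    (CNF.Unsat.liftInd hφ).exists_treeResParityDerives
  obtain ⟨D, hD, r, hr, h⟩ := TreeResParityDerives.exists_treeResDerives hℓ (Nat.sInf_mem hne)
    (fun _ => none) Set.univ
    ⟨fun _ _ _ _ _ _ => trivial, fun _ _ _ _ h => (Option.some_ne_none _ h.symm).elim,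
      fun a => ⟨a, trivial, fun _ _ => rfl⟩⟩ fun _ _ => trivial
  have hempty : D = ∅ := Finset.eq_empty_of_forall_notMem fun q hq => by
    simpa [mem_assignmentClause] using hD hq
  exact ⟨r, hr, hempty ▸ h⟩

end Simulation

end ProofComplexity

open ProofComplexity
theorem mainTheorem7 :
    ∃ ℓ₀ : ℕ, ∀ ℓ : ℕ, ℓ₀ ≤ ℓ → ∀ (N k : ℕ) (φ : CNF (Fin N)),
      CNF.IsKCNF φ k → CNF.Unsat φ →
        Fintype.card (IndVar N ℓ) = N * (ℓ + 2 ^ ℓ) ∧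
        CNF.IsKCNF (liftInd φ ℓ) (k * (ℓ + 1)) ∧
        (liftInd φ ℓ).card ≤ (2 ^ ℓ) ^ k * φ.card ∧
        ((∀ C ∈ φ, C.card = k) → (liftInd φ ℓ).card = (2 ^ ℓ) ^ k * φ.card) ∧
        ((∀ C ∈ φ, C.card = k ∧ Clause.DistinctVars C) →
          ∀ D ∈ liftInd φ ℓ, D.card = k * (ℓ + 1) ∧ Clause.DistinctVars D) ∧
        treeRes φ ≤ treeResParity (liftInd φ ℓ) ∧
        (2 : ℝ) ^ ((widthRes φ : ℤ) - (k : ℤ)) ≤ (treeRes φ : ℝ) := by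
  -- One address bit is enough: stifling only needs a second index.
  refine ⟨1, fun ℓ hℓ N k φ hk hφ => ⟨?_, ?_, card_liftInd_le hk, card_liftInd_eq, ?_, ?_, ?_⟩⟩
  · simp [mul_add]
  · intro D hD
    obtain ⟨C, hC, j, rfl⟩ := mem_liftInd.1 hD
    exact (card_liftClause_le C j).trans (Nat.mul_le_mul_right _ (hk C hC))
  · intro h D hD
    obtain ⟨C, hC, j, rfl⟩ := mem_liftInd.1 hD
    exact ⟨by rw [card_liftClause (h C hC).2, (h C hC).1], distinctVars_liftClause (h C hC).2 j⟩
  · obtain ⟨r, hr, h⟩ := exists_treeResDerives_le_treeResParity hℓ hφ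
    exact (Nat.sInf_le h).trans hr
  -- Only the existence of a tree-like resolution refutation is used, so that the infimum defining
  -- `treeRes` is attained.
  · obtain ⟨r, _, h⟩ := exists_treeResDerives_le_treeResParity hℓ hφ
    exact two_pow_widthRes_sub_le hk (Nat.sInf_mem (s := {s | TreeResDerives φ ∅ s}) ⟨r, h⟩)
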